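/- Let $(W,S)$ be a finite Coxeter system with set of reflections $T=\bigcup_{w\in W} wSw^{-1}$. Let $\ell_T(w)$ be the least $k$ such that $w$ is a product of $k$ elements of $T$. The absolute order on $W$ is defined by $v\le_T w$ if and only if $\ell_T(v)+\ell_T(v^{-1}w)=\ell_T(w)$, and for $u \in W$ we write $[1,u]_T=\{w\in W : 1\le_T w\le_T u\}$, ordered by $\le_T$. A parabolic subgroup of $W$ is a subgroup of the form $w\langle I\rangle w^{-1}$ with $I\subseteq S$ and $w\in W$; the parabolic closure $P(w)$ of $w\in W$ is the smallest parabolic subgroup containing $w$, that is, the intersection of all parabolic subgroups containing $w$. A parabolic subgroup $P$ is called involutive if $P=P(x)$ for some $x\in W$ with $x^2=1$. Theorem. Let $u\in W$ satisfy $u^2=1$, and let $\mathcal{IP}(u)$ be the set of involutive parabolic subgroups of $W$ contained in $P(u)$. Then $[1,u]_T$ is a lattice if and only if $\mathcal{IP}(u)$ is closed under intersection, that is, $P\cap Q\in\mathcal{IP}(u)$ for all $P,Q\in\mathcal{IP}(u)$. Moreover, if $[1,u]_T$ is a lattice, then for all $v,w\in[1,u]_T$ the meet $v\wedge w$ in $[1,u]_T$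 satisfies $P(v\wedge w)=P(v)\cap P(w)$. -/

import Mathlib

namespace CoxeterSystem

/-- `w` is a product of `k` reflections. -/
def IsProdOfReflections {B W : Type*} [Group W] {M : CoxeterMatrix B}
    (cs : CoxeterSystem M W) (w : W) (k : ℕ) : Prop :=
  ∃ l : List W, (∀ t ∈ l, cs.IsReflection t) ∧ l.prod = w ∧ l.length = k

/-- The reflection length: the least number of reflections with product `w`
(such an expression always exists, see `isProdOfReflections_reflLength`). -/
noncomputable def reflLength {B W : Type*} [Group W] {M : CoxeterMatrix B}
    (cs : CoxeterSystem M W) (w : W) : ℕ :=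
  sInf {k : ℕ | cs.IsProdOfReflections w k}

theorem isProdOfReflections_reflLength {B W : Type*} [Group W] {M : CoxeterMatrix B}
    (cs : CoxeterSystem M W) (w : W) : cs.IsProdOfReflections w (cs.reflLength w) := by
  obtain ⟨ω, hω⟩ := cs.wordProd_surjective w
  have hne : {k : ℕ | cs.IsProdOfReflections w k}.Nonempty := by
    refine ⟨_, ω.map cs.simple, ?_, hω, rfl⟩
    intro t ht
    obtain ⟨i, -, rfl⟩ := List.mem_map.1 ht
    exact cs.isReflection_simple i
  exact Nat.sInf_mem hne

theorem reflLength_le {B W : Type*} [Group W] {M : CoxeterMatrix B}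
    (cs : CoxeterSystem M W) {w : W} {k : ℕ} (h : cs.IsProdOfReflections w k) :
    cs.reflLength w ≤ k :=
  Nat.sInf_le h

theorem reflLength_one {B W : Type*} [Group W] {M : CoxeterMatrix B}
    (cs : CoxeterSystem M W) : cs.reflLength 1 = 0 :=
  Nat.le_zero.1 (cs.reflLength_le ⟨[], by simp, rfl, rfl⟩)

theorem eq_one_of_reflLength_eq_zero {B W : Type*} [Group W] {M : CoxeterMatrix B}
    (cs : CoxeterSystem M W) {w : W} (h : cs.reflLength w = 0) : w = 1 := by
  obtain ⟨l, -, hl, hk⟩ := cs.isProdOfReflections_reflLength w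
  rw [h] at hk
  rw [← hl, List.length_eq_zero_iff.1 hk, List.prod_nil]

theorem reflLength_mul_le {B W : Type*} [Group W] {M : CoxeterMatrix B}
    (cs : CoxeterSystem M W) (v w : W) :
    cs.reflLength (v * w) ≤ cs.reflLength v + cs.reflLength w := by
  obtain ⟨l, hl, hv, hk⟩ := cs.isProdOfReflections_reflLength v
  obtain ⟨l', hl', hw, hk'⟩ := cs.isProdOfReflections_reflLength w
  refine cs.reflLength_le ⟨l ++ l', ?_, by simp [hv, hw], by simp [hk, hk']⟩
  intro t ht
  rcases List.mem_append.1 ht with h | h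
  · exact hl t h
  · exact hl' t h

/-- The absolute order `v ≤_T w`. -/
def AbsLE {B W : Type*} [Group W] {M : CoxeterMatrix B}
    (cs : CoxeterSystem M W) (v w : W) : Prop :=
  cs.reflLength v + cs.reflLength (v⁻¹ * w) = cs.reflLength w

theorem absLE_refl {B W : Type*} [Group W] {M : CoxeterMatrix B}
    (cs : CoxeterSystem M W) (v : W) : cs.AbsLE v v := by
  simp [AbsLE, reflLength_one]

theorem absLE_trans {B W : Type*} [Group W] {M : CoxeterMatrix B}
    (cs : CoxeterSystem M W) {v w x : W} (h : cs.AbsLE v w) (h' : cs.AbsLE w x) :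
    cs.AbsLE v x := by
  unfold AbsLE at *
  have h1 := cs.reflLength_mul_le (v⁻¹ * w) (w⁻¹ * x)
  have h2 := cs.reflLength_mul_le v (v⁻¹ * x)
  have e1 : v⁻¹ * w * (w⁻¹ * x) = v⁻¹ * x := by group
  have e2 : v * (v⁻¹ * x) = x := by group
  rw [e1] at h1
  rw [e2] at h2
  omega

theorem absLE_antisymm {B W : Type*} [Group W] {M : CoxeterMatrix B}
    (cs : CoxeterSystem M W) {v w : W} (h : cs.AbsLE v w) (h' : cs.AbsLE w v) : v = w := by
  unfold AbsLE at *
  have h0 : cs.reflLength (v⁻¹ * w) = 0 := by omega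
  exact inv_mul_eq_one.1 (cs.eq_one_of_reflLength_eq_zero h0)

/-- The interval `[a, b]_T` for the absolute order. -/
def AbsInterval {B W : Type*} [Group W] {M : CoxeterMatrix B}
    (cs : CoxeterSystem M W) (a b : W) : Type _ :=
  {w : W // cs.AbsLE a w ∧ cs.AbsLE w b}

/-- The interval `[a, b]_T` is ordered by the restriction of the absolute order. -/
instance absIntervalPartialOrder {B W : Type*} [Group W] {M : CoxeterMatrix B}
    (cs : CoxeterSystem M W) (a b : W) : PartialOrder (cs.AbsInterval a b) where
  le v w := cs.AbsLE v.1 w.1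
  le_refl v := cs.absLE_refl v.1
  le_trans _ _ _ h h' := cs.absLE_trans h h'
  le_antisymm _ _ h h' := Subtype.ext (cs.absLE_antisymm h h')

/-- The standard parabolic subgroup `W_I`. -/
def standardParabolic {B W : Type*} [Group W] {M : CoxeterMatrix B}
    (cs : CoxeterSystem M W) (I : Set B) : Subgroup W :=
  Subgroup.closure (cs.simple '' I)

/-- Parabolic subgroups are the conjugates `w W_I w⁻¹` of standard parabolic subgroups. -/
def IsParabolic {B W : Type*} [Group W] {M : CoxeterMatrix B}
    (cs : CoxeterSystem M W) (P : Subgroup W) : Prop :=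
  ∃ (I : Set B) (w : W), P = (cs.standardParabolic I).map (MulAut.conj w).toMonoidHom

/-- The parabolic closure `P(w)`: the intersection of all parabolic subgroups containing `w`,
which is the smallest of them because parabolic subgroups are stable by intersection. -/
def parabolicClosure {B W : Type*} [Group W] {M : CoxeterMatrix B}
    (cs : CoxeterSystem M W) (w : W) : Subgroup W :=
  sInf {P : Subgroup W | cs.IsParabolic P ∧ w ∈ P}

/-- A parabolic subgroup is involutive if it is the parabolic closure of some `x` with
`x ^ 2 = 1`. -/
def IsInvolutiveParabolic {B W : Type*} [Group W] {M : CoxeterMatrix B}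
    (cs : CoxeterSystem M W) (P : Subgroup W) : Prop :=
  cs.IsParabolic P ∧ ∃ x : W, x ^ 2 = 1 ∧ cs.parabolicClosure x = P

/-- The set `IP(u)` of involutive parabolic subgroups contained in `P(u)`. -/
def involutiveParabolics {B W : Type*} [Group W] {M : CoxeterMatrix B}
    (cs : CoxeterSystem M W) (u : W) : Set (Subgroup W) :=
  {P | cs.IsInvolutiveParabolic P ∧ P ≤ cs.parabolicClosure u}

end CoxeterSystem

/-- A partially ordered set is a lattice if any two elements have a meet and a join. -/
def IsLatticeOrder (α : Type*) [PartialOrder α] : Prop :=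
  ∀ a b : α, (∃ m, IsGLB {a, b} m) ∧ (∃ j, IsLUB {a, b} j)

/-! The group acts by isometries on a Euclidean space `E`, and its parabolic subgroups are exactly
the pointwise fixers of subspaces. In particular `P(w)` is the fixer of `Fix(w)`. Carter's lemma
(`reflLength_add_finrank_fixedSpace`) says that reflection length is the codimension of the fixed
space. It follows that, below an involution `u`, the absolute order is containment of fixed spaces:
`v ≤ u` iff `v` is an involution with `P(v) ≤ P(u)`. Hence `v ↦ P(v)` is an order isomorphism from
the interval onto `IP(u)` ordered by inclusion.

If `IP(u)` is closed under intersection, meets exist, and a finite poset with a top and binary meets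
is a lattice. Conversely, let `m` be the meet of `v` and `w`. The intersection `P(v) ∩ P(w)` is
parabolic, so it is generated by its reflections. Each of these is an involution below `v` and `w`,
hence below `m`, hence in `P(m)`. So `P(m) = P(v) ∩ P(w)` (`parabolicClosure_isGLB`). -/

namespace CoxeterMatrix

/-! ### The geometric representation and its braid relations. -/

variable {B : Type*} (M : CoxeterMatrix B)

/-- The coroot of the standard geometric representation: the linear form
`α_j ↦ -2 cos (π / M i j)`. -/
noncomputable def coroot (i : B) : Module.Dual ℝ (B →₀ ℝ) :=
  Finsupp.linearCombination ℝ fun j => -2 * Real.cos (Real.pi / M i j)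

/-- The simple roots of the standard geometric representation. -/
noncomputable def simpleRoot (i : B) : B →₀ ℝ := Finsupp.single i 1

theorem coroot_simpleRoot (i j : B) :
    M.coroot i (simpleRoot j) = -2 * Real.cos (Real.pi / M i j) := by
  simp [coroot, simpleRoot]

theorem coroot_simpleRoot_self (i : B) : M.coroot i (simpleRoot i) = 2 := by
  simp [coroot_simpleRoot]

theorem coroot_simpleRoot_comm (i j : B) :
    M.coroot i (simpleRoot j) = M.coroot j (simpleRoot i) := by
  rw [coroot_simpleRoot, coroot_simpleRoot, M.symmetric]

/-- The simple reflections of the standard geometric representation. -/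
noncomputable def geomReflection (i : B) : (B →₀ ℝ) ≃ₗ[ℝ] (B →₀ ℝ) :=
  Module.reflection (M.coroot_simpleRoot_self i)

theorem geomReflection_apply (i : B) (x : B →₀ ℝ) :
    M.geomReflection i x = x - M.coroot i x • simpleRoot i :=
  Module.reflection_apply _ _

theorem sin_two_pi_div_ne_zero {m : ℕ} (hm : 3 ≤ m) :
    Real.sin (2 * (Real.pi / m)) ≠ 0 := by
  have hm' : (3 : ℝ) ≤ m := by exact_mod_cast hm
  have hpi := Real.pi_pos
  refine (Real.sin_pos_of_pos_of_lt_pi (by positivity) ?_).ne'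
  rw [← mul_div_assoc, div_lt_iff₀ (by linarith)]
  nlinarith

open Polynomial.Chebyshev in
theorem eval_S_eq_div {m : ℕ} (hm : 3 ≤ m) (n : ℤ) :
    (S ℝ n).eval (2 * Real.cos (2 * (Real.pi / m))) =
      Real.sin ((n + 1) * (2 * (Real.pi / m))) / Real.sin (2 * (Real.pi / m)) := by
  rw [eq_div_iff (sin_two_pi_div_ne_zero hm), S_two_mul_real_cos]

open Polynomial.Chebyshev in
-- These are the coefficients in the formula for the `m`-th power of a product of two reflections.
-- With `θ = 2π/m`, if `m = 2p` then `S (p - 1)` vanishes because `pθ = π`; if `m = 2p + 1` then `S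
-- p` and `S (p - 1)` cancel because `(p + 1)θ = 2π - pθ`.
theorem eval_S_coefficients {m : ℕ} (hm : 3 ≤ m) :
    (S ℝ ((m - 2 : ℤ) / 2)).eval (2 * Real.cos (2 * (Real.pi / m))) *
      ((S ℝ ((m - 1 : ℤ) / 2)).eval (2 * Real.cos (2 * (Real.pi / m))) +
        (S ℝ ((m - 3 : ℤ) / 2)).eval (2 * Real.cos (2 * (Real.pi / m)))) = 0 ∧
    (S ℝ ((m - 1 : ℤ) / 2)).eval (2 * Real.cos (2 * (Real.pi / m))) *
      ((S ℝ ((m : ℤ) / 2)).eval (2 * Real.cos (2 * (Real.pi / m))) +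
        (S ℝ ((m - 2 : ℤ) / 2)).eval (2 * Real.cos (2 * (Real.pi / m)))) = 0 := by
  have hm0 : (m : ℝ) ≠ 0 := by positivity
  rcases Nat.even_or_odd' m with ⟨p, hp | hp⟩
  · have e1 : (m - 2 : ℤ) / 2 = p - 1 := by omega
    have e2 : (m - 1 : ℤ) / 2 = p - 1 := by omega
    have h0 : (S ℝ (p - 1 : ℤ)).eval (2 * Real.cos (2 * (Real.pi / m))) = 0 := by
      rw [eval_S_eq_div hm, div_eq_zero_iff]
      left
      have : (((p - 1 : ℤ) : ℝ) + 1) * (2 * (Real.pi / m)) = Real.pi := by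
        have : (m : ℝ) = 2 * p := by exact_mod_cast hp
        push_cast
        field_simp
        linarith
      rw [this, Real.sin_pi]
    rw [e1, e2, h0]
    simp
  · have e1 : (m - 2 : ℤ) / 2 = p - 1 := by omega
    have e2 : (m - 1 : ℤ) / 2 = p := by omega
    have e3 : (m - 3 : ℤ) / 2 = p - 1 := by omega
    have e4 : (m : ℤ) / 2 = p := by omega
    have h0 : (S ℝ (p : ℤ)).eval (2 * Real.cos (2 * (Real.pi / m))) +
        (S ℝ (p - 1 : ℤ)).eval (2 * Real.cos (2 * (Real.pi / m))) = 0 := by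
      rw [eval_S_eq_div hm, eval_S_eq_div hm, ← add_div, div_eq_zero_iff]
      left
      have h : (m : ℝ) = 2 * p + 1 := by exact_mod_cast hp
      have : (((p : ℤ) : ℝ) + 1) * (2 * (Real.pi / m)) =
          2 * Real.pi - (((p - 1 : ℤ) : ℝ) + 1) * (2 * (Real.pi / m)) := by
        push_cast
        field_simp
        linarith
      rw [this, Real.sin_two_pi_sub]
      ring
    rw [e1, e2, e3, e4, h0]
    simp

theorem isLiftable_geomReflection : M.IsLiftable M.geomReflection := by
  intro i j
  ext1 z
  rcases eq_or_ne i j with rfl | hij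
  · rw [M.diagonal, pow_one, LinearEquiv.mul_apply, LinearEquiv.coe_one, id]
    exact Module.involutive_reflection (M.coroot_simpleRoot_self i) z
  -- The sine quotient needs `m ≥ 3`, since `sin (2π/m) = 0` for `m = 2`. For `m = 2` the roots are
  -- orthogonal and the reflections commute; `m = 0` encodes infinite order and imposes no relation.
  rcases Nat.lt_or_ge (M i j) 3 with hm | hm
  · have h1 := M.off_diagonal i j hij
    change M i j ≠ 1 at h1
    interval_cases hk : M i j
    · simp
    · exact absurd rfl h1
    · have h0 : M.coroot i (simpleRoot j) = 0 := by
        rw [coroot_simpleRoot, hk]; simp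
      have h0' : M.coroot j (simpleRoot i) = 0 := by
        rw [← coroot_simpleRoot_comm, h0]
      simp only [pow_two, LinearEquiv.mul_apply, geomReflection_apply, map_sub, map_smul, h0, h0',
        coroot_simpleRoot_self, LinearEquiv.coe_one, id]
      module
  · have ht : 2 * Real.cos (2 * (Real.pi / M i j)) =
        M.coroot i (simpleRoot j) * M.coroot j (simpleRoot i) - 2 := by
      rw [M.coroot_simpleRoot_comm j i, coroot_simpleRoot, Real.cos_two_mul]
      ring
    have := Module.reflection_mul_reflection_pow_apply (M.coroot_simpleRoot_self i)
      (M.coroot_simpleRoot_self j) (M i j) z _ ht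
    rw [(eval_S_coefficients hm).1, (eval_S_coefficients hm).2] at this
    simpa [geomReflection] using this

end CoxeterMatrix

/-! ### Positivity of roots. -/

namespace CoxeterSystem

open CoxeterMatrix

variable {B W : Type*} [Group W] {M : CoxeterMatrix B} (cs : CoxeterSystem M W)

/-- The standard geometric representation. -/
noncomputable def geomRep : W →* ((B →₀ ℝ) ≃ₗ[ℝ] (B →₀ ℝ)) :=
  cs.lift ⟨M.geomReflection, M.isLiftable_geomReflection⟩

theorem geomRep_simple (i : B) (x : B →₀ ℝ) :
    cs.geomRep (cs.simple i) x = x - M.coroot i x • simpleRoot i := by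
  rw [geomRep, lift_apply_simple, geomReflection_apply]

theorem geomRep_mul_apply (v w : W) (x : B →₀ ℝ) :
    cs.geomRep (v * w) x = cs.geomRep v (cs.geomRep w x) := by
  rw [map_mul, LinearEquiv.mul_apply]

/-- The coefficients `sin (k θ) / sin θ`, `θ = π / m`, by which alternating words act. -/
noncomputable def dihedralCoeff (c : ℝ) : ℕ → ℝ
  | 0 => 0
  | 1 => 1
  | k + 2 => 2 * c * dihedralCoeff c (k + 1) - dihedralCoeff c k

theorem dihedralCoeff_one (k : ℕ) : dihedralCoeff 1 k = k := by
  induction k using Nat.twoStepInduction with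
  | zero => simp [dihedralCoeff]
  | one => simp [dihedralCoeff]
  | more k h1 h2 =>
    rw [dihedralCoeff, h1, h2]
    push_cast
    ring

theorem dihedralCoeff_cos_mul_sin (θ : ℝ) (k : ℕ) :
    dihedralCoeff (Real.cos θ) k * Real.sin θ = Real.sin (k * θ) := by
  induction k using Nat.twoStepInduction with
  | zero => simp [dihedralCoeff]
  | one => simp [dihedralCoeff]
  | more k h1 h2 =>
    rw [dihedralCoeff, sub_mul, h1, mul_assoc, h2]
    have e1 : ((k + 2 : ℕ) : ℝ) * θ = ((k + 1 : ℕ) : ℝ) * θ + θ := by push_cast; ring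
    have e2 : (k : ℝ) * θ = ((k + 1 : ℕ) : ℝ) * θ - θ := by push_cast; ring
    rw [e1, e2, Real.sin_add, Real.sin_sub]
    ring

theorem dihedralCoeff_nonneg {m k : ℕ} (hm : m ≠ 1) (hk : m ≠ 0 → k ≤ m) :
    0 ≤ dihedralCoeff (Real.cos (Real.pi / m)) k := by
  rcases eq_or_ne m 0 with rfl | h0
  -- Here `π / 0 = 0`, so the cosine is `1` and the recursion gives the coefficient `k`, where a
  -- quotient of sines would be `0 / 0`.
  · simp [dihedralCoeff_one]
  have hpi := Real.pi_pos
  have hm2 : (2 : ℝ) ≤ m := by exact_mod_cast (by omega : 2 ≤ m)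
  have hkm : (k : ℝ) ≤ m := by exact_mod_cast hk h0
  have hs : 0 < Real.sin (Real.pi / m) := by
    apply Real.sin_pos_of_pos_of_lt_pi (by positivity)
    rw [div_lt_iff₀ (by linarith)]
    nlinarith
  refine nonneg_of_mul_nonneg_left ?_ hs
  rw [dihedralCoeff_cos_mul_sin]
  apply Real.sin_nonneg_of_nonneg_of_le_pi (by positivity)
  rw [← mul_div_assoc, div_le_iff₀ (by linarith)]
  nlinarith

theorem geomRep_alternatingWord (i j : B) (k : ℕ) :
    cs.geomRep (cs.wordProd (alternatingWord i j k)) (simpleRoot i) =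
      dihedralCoeff (Real.cos (Real.pi / M i j)) (k + 1) •
        simpleRoot (if Even k then i else j) +
      dihedralCoeff (Real.cos (Real.pi / M i j)) k • simpleRoot (if Even k then j else i) := by
  induction k with
  | zero => simp [alternatingWord, dihedralCoeff]
  | succ k ih =>
    rw [alternatingWord_succ', wordProd_cons, geomRep_mul_apply, ih, dihedralCoeff]
    have h1 := M.coroot_simpleRoot_self
    have h2 := M.coroot_simpleRoot i j
    have h3 := M.coroot_simpleRoot j i
    rw [M.symmetric] at h3
    by_cases hk : Even k
    · have hk' : ¬ Even (k + 1) := by simpa [Nat.even_add_one] using hk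
      simp only [hk, hk', if_true, if_false, geomRep_simple, map_add, map_smul, h1, h3]
      module
    · have hk' : Even (k + 1) := by simpa [Nat.even_add_one] using hk
      simp only [hk, hk', if_true, if_false, geomRep_simple, map_add, map_smul, h1, h2]
      module

/-- Letters `i`, `j` are stripped alternately from the right of `w` as long as the length drops. The
descent hypothesis says that the letter just stripped cannot be stripped again. The remaining `v'`
is minimal in its coset of the dihedral subgroup. -/
theorem exists_eq_mul_alternatingWord (i j : B) (w : W) :
    ∀ (n k : ℕ) (v : W), cs.length v = n → w = v * cs.wordProd (alternatingWord i j k) →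
      cs.length w = cs.length v + k →
      ¬ cs.IsRightDescent v (if Even k then i else j) →
      ∃ (v' : W) (k' : ℕ), w = v' * cs.wordProd (alternatingWord i j k') ∧
        cs.length w = cs.length v' + k' ∧ ¬ cs.IsRightDescent v' i ∧ ¬ cs.IsRightDescent v' j := by
  intro n
  induction n with
  | zero =>
    intro k v hv hw hl _
    obtain rfl := cs.length_eq_zero_iff.1 hv
    exact ⟨1, k, hw, hl, cs.not_isRightDescent_one i, cs.not_isRightDescent_one j⟩
  | succ n ih =>
    intro k v hv hw hl hd
    by_cases hd' : cs.IsRightDescent v (if Even k then j else i)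
    · have hx := cs.isRightDescent_iff.1 hd'
      refine ih (k + 1) (v * cs.simple (if Even k then j else i)) (by omega) ?_ (by omega) ?_
      · rw [alternatingWord_succ', wordProd_cons, ← mul_assoc, simple_mul_simple_cancel_right, hw]
      · have : (if Even (k + 1) then i else j) = if Even k then j else i := by
          by_cases hk : Even k <;> simp [hk, Nat.even_add_one]
        rw [this]
        exact cs.isRightDescent_iff_not_isRightDescent_mul.1 hd'
    · by_cases hk : Even k <;> simp only [hk, if_true, if_false] at hd hd'
      · exact ⟨v, k, hw, hl, hd, hd'⟩
      · exact ⟨v, k, hw, hl, hd', hd⟩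

/-- If `w sᵢ` is longer than `w`, then `w αᵢ` is a positive root. -/
theorem geomRep_simpleRoot_nonneg (n : ℕ) : ∀ (w : W) (i : B), cs.length w = n →
    ¬ cs.IsRightDescent w i → ∀ b, 0 ≤ cs.geomRep w (simpleRoot i) b := by
  induction n using Nat.strong_induction_on with
  | _ n ih =>
  intro w i hw hi b
  rcases eq_or_ne w 1 with rfl | hw1
  · rw [map_one, LinearEquiv.coe_one, id, simpleRoot]
    classical
    rw [Finsupp.single_apply]
    split_ifs <;> simp
  -- Write `w = v d` with `d` in the dihedral group of `i`, `j`. Then `d αᵢ` is a nonnegative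
  -- combination of `αᵢ`, `αⱼ`, and induction applies to the shorter element `v`.
  obtain ⟨j, hj⟩ := cs.exists_rightDescent_of_ne_one hw1
  have hij : i ≠ j := by rintro rfl; exact hi hj
  obtain ⟨v, k, hwv, hl, hvi, hvj⟩ := cs.exists_eq_mul_alternatingWord i j w _ 0 w rfl
    (by simp [alternatingWord]) (by simp) (by simpa using hi)
  have hk0 : k ≠ 0 := by
    rintro rfl
    have : w = v := by simpa [alternatingWord] using hwv
    exact hvj (this ▸ hj)
  have hM1 : M i j ≠ 1 := M.off_diagonal i j hij
  -- If `k > M i j` the alternating word is not reduced, against additivity of lengths. If `k = M i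
  -- j` the braid relation makes it end in `i`, so `i` would be a descent of `w`.
  have hkM : M i j ≠ 0 → k + 1 ≤ M i j := by
    intro hM0
    by_contra hlt
    rcases Nat.lt_or_ge (M i j) k with hlt' | hge
    · refine cs.not_isReduced_alternatingWord i j hM0 hlt' ?_
      have h1 := cs.length_mul_le v (cs.wordProd (alternatingWord i j k))
      have h2 := cs.length_wordProd_le (alternatingWord i j k)
      rw [← hwv] at h1
      rw [IsReduced]
      rw [length_alternatingWord] at h2 ⊢
      omega
    · obtain rfl : k = M i j := by omega
      obtain ⟨p, hp⟩ := Nat.exists_eq_succ_of_ne_zero hM0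
      have hb : cs.wordProd (alternatingWord i j (M i j)) =
          cs.wordProd (alternatingWord i j p) * cs.simple i := by
        have := cs.wordProd_braidWord_eq i j
        rw [braidWord, braidWord, M.symmetric j i] at this
        rw [this, hp, alternatingWord_succ, wordProd_concat]
      have hws : w * cs.simple i = v * cs.wordProd (alternatingWord i j p) := by
        rw [hwv, hb, ← mul_assoc, simple_mul_simple_cancel_right]
      have h1 := cs.length_mul_le v (cs.wordProd (alternatingWord i j p))
      have h2 := cs.length_wordProd_le (alternatingWord i j p)
      rw [length_alternatingWord] at h2
      rw [← hws] at h1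
      apply hi
      rw [IsRightDescent]
      omega
  have hc1 : 0 ≤ dihedralCoeff (Real.cos (Real.pi / M i j)) (k + 1) :=
    dihedralCoeff_nonneg hM1 hkM
  have hc2 : 0 ≤ dihedralCoeff (Real.cos (Real.pi / M i j)) k :=
    dihedralCoeff_nonneg hM1 fun h => (Nat.le_succ k).trans (hkM h)
  have hvi' := ih _ (by omega) v i rfl hvi b
  have hvj' := ih _ (by omega) v j rfl hvj b
  rw [hwv, geomRep_mul_apply, geomRep_alternatingWord]
  simp only [map_add, map_smul, Finsupp.add_apply, Finsupp.smul_apply, smul_eq_mul]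
  by_cases hk : Even k <;> simp only [hk, if_true, if_false] <;> positivity

theorem simple_injective : Function.Injective cs.simple := by
  intro i j hij
  by_contra hne
  have h1 := cs.geomRep_simple i (simpleRoot i)
  rw [hij, geomRep_simple, coroot_simpleRoot_self] at h1
  have h2 := DFunLike.congr_fun h1 i
  simp [simpleRoot, Ne.symm hne] at h2
  norm_num at h2

theorem finite_index {B W : Type*} [Group W] [Finite W] {M : CoxeterMatrix B}
    (cs : CoxeterSystem M W) : Finite B :=
  Finite.of_injective _ cs.simple_injective

end CoxeterSystem

/-! ### An invariant inner product. -/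

namespace CoxeterSystem

open CoxeterMatrix Module

/-- An action of a Coxeter group on a Euclidean space by isometries in which the simple
reflections are orthogonal reflections along a basis of simple roots, and in which `w αᵢ` is a
positive root whenever `w sᵢ` is longer than `w`. -/
structure EuclideanRealization {B W : Type*} [Group W] {M : CoxeterMatrix B}
    (cs : CoxeterSystem M W) (E : Type*) [NormedAddCommGroup E] [InnerProductSpace ℝ E] where
  /-- The action by isometries. -/
  rep : W →* (E ≃ₗᵢ[ℝ] E)
  /-- The simple roots. -/
  root : Basis B ℝ E
  rep_simple : ∀ i x, rep (cs.simple i) x =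
    x - (2 * inner ℝ (root i) x / inner ℝ (root i) (root i)) • root i
  repr_nonneg : ∀ w i, ¬ cs.IsRightDescent w i → ∀ b, 0 ≤ root.repr (rep w (root i)) b

/-- The average of the standard inner product over a finite group. -/
@[reducible]
noncomputable def averagedInnerCore {G B : Type*} [Group G] [Fintype G] [Fintype B]
    (ρ : G →* ((B →₀ ℝ) ≃ₗ[ℝ] (B →₀ ℝ))) : InnerProductSpace.Core ℝ (B →₀ ℝ) where
  inner x y := ∑ g, ∑ b, ρ g x b * ρ g y b
  conj_inner_symm x y := by simp [mul_comm]
  re_inner_nonneg x := by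
    simpa using Finset.sum_nonneg fun g _ => Finset.sum_nonneg fun b _ => mul_self_nonneg (ρ g x b)
  add_left x y z := by simp [add_mul, Finset.sum_add_distrib]
  smul_left x y r := by simp [Finset.mul_sum, mul_assoc]
  definite x hx := by
    rw [Finset.sum_eq_zero_iff_of_nonneg
      fun g _ => Finset.sum_nonneg fun b _ => mul_self_nonneg _] at hx
    have h1 := hx 1 (Finset.mem_univ _)
    rw [Finset.sum_eq_zero_iff_of_nonneg fun b _ => mul_self_nonneg _] at h1
    ext b
    simpa using h1 b (Finset.mem_univ _)

theorem averagedInnerCore_inner_map {G B : Type*} [Group G] [Fintype G] [Fintype B]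
    (ρ : G →* ((B →₀ ℝ) ≃ₗ[ℝ] (B →₀ ℝ))) (g : G) (x y : B →₀ ℝ) :
    (averagedInnerCore ρ).inner (ρ g x) (ρ g y) = (averagedInnerCore ρ).inner x y := by
  change ∑ h, ∑ b, ρ h (ρ g x) b * ρ h (ρ g y) b = ∑ h, ∑ b, ρ h x b * ρ h y b
  simp only [← LinearEquiv.mul_apply, ← map_mul]
  exact Fintype.sum_equiv (Equiv.mulRight g) _ _ fun h => rfl

/-- A linear reflection which preserves an inner product is an orthogonal reflection. -/
theorem eq_two_mul_inner_div_of_isometry {E : Type*} [NormedAddCommGroup E]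
    [InnerProductSpace ℝ E] {s : E ≃ₗᵢ[ℝ] E} {f : E → ℝ} {a : E} (ha : a ≠ 0)
    (hs : ∀ x, s x = x - f x • a) (hf : f a = 2) (x : E) :
    f x = 2 * inner ℝ a x / inner ℝ a a := by
  have h1 : inner ℝ (s a) (s x) = inner ℝ a x := s.inner_map_map a x
  have h2 : s a = -a := by rw [hs, hf, two_smul]; abel
  have h3 : inner ℝ a a ≠ 0 := inner_self_ne_zero.2 ha
  rw [h2, hs, inner_neg_left, inner_sub_right, inner_smul_right] at h1
  rw [eq_div_iff h3]
  linarith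

theorem exists_euclideanRealization {B W : Type*} [Group W] [Finite W] {M : CoxeterMatrix B}
    (cs : CoxeterSystem M W) :
    ∃ (_ : NormedAddCommGroup (B →₀ ℝ)) (_ : InnerProductSpace ℝ (B →₀ ℝ)),
      Nonempty (cs.EuclideanRealization (B →₀ ℝ)) := by
  have := cs.finite_index
  have := Fintype.ofFinite B
  have := Fintype.ofFinite W
  let c := averagedInnerCore cs.geomRep
  let nacg : NormedAddCommGroup (B →₀ ℝ) := c.toNormedAddCommGroup
  let ips : InnerProductSpace ℝ (B →₀ ℝ) := InnerProductSpace.ofCore c.toCore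
  refine ⟨nacg, ips, ⟨?_⟩⟩
  let rep : W →* ((B →₀ ℝ) ≃ₗᵢ[ℝ] (B →₀ ℝ)) :=
    { toFun := fun w => (cs.geomRep w).isometryOfInner
        (averagedInnerCore_inner_map cs.geomRep w)
      map_one' := by ext1 x; change cs.geomRep 1 x = x; rw [map_one]; rfl
      map_mul' := fun v w => by
        ext1 x
        exact cs.geomRep_mul_apply v w x }
  exact
    { rep := rep
      root := Finsupp.basisSingleOne
      rep_simple := fun i x => by
        have := eq_two_mul_inner_div_of_isometry (s := rep (cs.simple i)) (f := M.coroot i)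
          (a := simpleRoot i) (by simp [simpleRoot]) (cs.geomRep_simple i)
          (M.coroot_simpleRoot_self i) x
        rw [Finsupp.coe_basisSingleOne]
        change _ = x - (2 * inner ℝ (simpleRoot i) x / inner ℝ (simpleRoot i) (simpleRoot i)) •
          simpleRoot i
        rw [← this]
        exact cs.geomRep_simple i x
      repr_nonneg := fun w i hi b => by
        rw [Finsupp.coe_basisSingleOne]
        exact cs.geomRep_simpleRoot_nonneg _ w i rfl hi b }

end CoxeterSystem

/-! ### Parabolic subgroups as pointwise fixers. -/

namespace CoxeterSystem

namespace EuclideanRealization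

open Module

variable {B W : Type*} [Group W] {M : CoxeterMatrix B} {cs : CoxeterSystem M W}
  {E : Type*} [NormedAddCommGroup E] [InnerProductSpace ℝ E] (R : cs.EuclideanRealization E)

theorem rep_mul_apply (v w : W) (x : E) : R.rep (v * w) x = R.rep v (R.rep w x) := by
  rw [map_mul, LinearIsometryEquiv.coe_mul, Function.comp_apply]

theorem rep_one_apply (x : E) : R.rep 1 x = x := by
  rw [map_one, LinearIsometryEquiv.coe_one, id]

theorem rep_inv_apply_eq_iff (w : W) (x y : E) : R.rep w⁻¹ x = y ↔ x = R.rep w y := by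
  constructor
  · rintro rfl
    rw [← rep_mul_apply, mul_inv_cancel, rep_one_apply]
  · rintro rfl
    rw [← rep_mul_apply, inv_mul_cancel, rep_one_apply]

theorem inner_rep_left (w : W) (x y : E) : inner ℝ (R.rep w x) y = inner ℝ x (R.rep w⁻¹ y) := by
  rw [← (R.rep w⁻¹).inner_map_map, ← rep_mul_apply, inv_mul_cancel, rep_one_apply]

/-- The subgroup of elements acting trivially on a subspace. -/
def fixingSubgroup (U : Submodule ℝ E) : Subgroup W where
  carrier := {w | ∀ x ∈ U, R.rep w x = x}
  one_mem' x _ := R.rep_one_apply x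
  mul_mem' {v w} hv hw x hx := by rw [rep_mul_apply, hw x hx, hv x hx]
  inv_mem' {w} hw x hx := by rw [rep_inv_apply_eq_iff, hw x hx]

theorem mem_fixingSubgroup {U : Submodule ℝ E} {w : W} :
    w ∈ R.fixingSubgroup U ↔ ∀ x ∈ U, R.rep w x = x := Iff.rfl

/-- The space of vectors fixed by a group element. -/
def fixedSpace (w : W) : Submodule ℝ E :=
  LinearMap.ker ((R.rep w).toLinearEquiv.toLinearMap - LinearMap.id)

theorem mem_fixedSpace {w : W} {x : E} : x ∈ R.fixedSpace w ↔ R.rep w x = x := by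
  simp [fixedSpace, sub_eq_zero]

theorem mem_fixingSubgroup_iff_le {U : Submodule ℝ E} {w : W} :
    w ∈ R.fixingSubgroup U ↔ U ≤ R.fixedSpace w := by
  simp only [mem_fixingSubgroup, SetLike.le_def, mem_fixedSpace]

/-- The closed fundamental chamber. -/
def IsDominant (x : E) : Prop := ∀ i, 0 ≤ inner ℝ x (R.root i)

theorem inner_root_self_pos (i : B) : 0 < inner ℝ (R.root i) (R.root i) :=
  real_inner_self_pos.2 (R.root.ne_zero i)

theorem rep_simple_root (i : B) : R.rep (cs.simple i) (R.root i) = -R.root i := by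
  rw [rep_simple, mul_div_assoc, div_self (R.inner_root_self_pos i).ne', mul_one, two_smul]
  abel

theorem rep_simple_eq_self_iff (i : B) (x : E) :
    R.rep (cs.simple i) x = x ↔ inner ℝ x (R.root i) = 0 := by
  rw [rep_simple, sub_eq_self, smul_eq_zero, div_eq_zero_iff, real_inner_comm]
  simp [R.root.ne_zero i]

variable {R} in
theorem IsDominant.inner_nonneg [Finite B] {x y : E} (hx : R.IsDominant x)
    (hy : ∀ b, 0 ≤ R.root.repr y b) : 0 ≤ inner ℝ x y := by
  have := Fintype.ofFinite B
  rw [← R.root.sum_repr y, inner_sum]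
  refine Finset.sum_nonneg fun b _ => ?_
  rw [inner_smul_right]
  exact mul_nonneg (hy b) (hx b)

theorem simple_mem_standardParabolic {I : Set B} {i : B} (hi : i ∈ I) :
    cs.simple i ∈ cs.standardParabolic I :=
  Subgroup.subset_closure ⟨i, hi, rfl⟩

variable {R} in
/-- The stabilizer of a point of the closed fundamental chamber is a standard parabolic
subgroup. -/
theorem IsDominant.mem_standardParabolic [Finite B] {x : E} (hx : R.IsDominant x) (n : ℕ) :
    ∀ w : W, cs.length w = n → R.rep w x = x →
      w ∈ cs.standardParabolic {i | inner ℝ x (R.root i) = 0} := by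
  induction n with
  | zero =>
    intro w hw _
    rw [cs.length_eq_zero_iff.1 hw]
    exact one_mem _
  | succ n ih =>
    intro w hw hwx
    have hw1 : w ≠ 1 := by
      rintro rfl
      simp at hw
    obtain ⟨i, hi⟩ := cs.exists_leftDescent_of_ne_one hw1
    have hi' : cs.IsRightDescent w⁻¹ i := cs.isRightDescent_inv_iff.2 hi
    have hpos := hx.inner_nonneg (R.repr_nonneg _ i
      (cs.isRightDescent_iff_not_isRightDescent_mul.1 hi'))
    -- The root `w⁻¹ αᵢ` is negative and `w` fixes `x`, so `⟨x, αᵢ⟩ ≤ 0`. Dominance forces equality,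
    -- so the simple reflection fixes `x` and can be removed from `w`.
    rw [rep_mul_apply, rep_simple_root, map_neg, inner_neg_right, ← inner_rep_left, hwx] at hpos
    have h0 : inner ℝ x (R.root i) = 0 := le_antisymm (by linarith) (hx i)
    have hmem := ih (cs.simple i * w) (by have := cs.isLeftDescent_iff.1 hi; omega)
      (by rw [rep_mul_apply, hwx, rep_simple_eq_self_iff, h0])
    rw [← cs.simple_mul_simple_cancel_left (w := w) i]
    exact mul_mem (simple_mem_standardParabolic h0) hmem

variable {R} in
theorem IsDominant.rep_eq_self_iff [Finite B] {x : E} (hx : R.IsDominant x) (w : W) :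
    R.rep w x = x ↔ w ∈ cs.standardParabolic {i | inner ℝ x (R.root i) = 0} := by
  refine ⟨hx.mem_standardParabolic _ w rfl, fun hw => ?_⟩
  have hle : cs.standardParabolic {i | inner ℝ x (R.root i) = 0} ≤
      R.fixingSubgroup (Submodule.span ℝ {x}) := by
    rw [standardParabolic, Subgroup.closure_le]
    rintro _ ⟨i, hi, rfl⟩
    rw [SetLike.mem_coe, mem_fixingSubgroup_iff_le, Submodule.span_singleton_le_iff_mem,
      mem_fixedSpace, rep_simple_eq_self_iff]
    exact hi
  exact hle hw x (Submodule.mem_span_singleton_self x)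

theorem exists_inner_root_eq [Finite B] (c : B → ℝ) : ∃ x : E, ∀ i, inner ℝ x (R.root i) = c i := by
  have : FiniteDimensional ℝ E := R.root.finiteDimensional_of_finite
  refine ⟨(InnerProductSpace.toDual ℝ E).symm
    (LinearMap.toContinuousLinearMap (R.root.constr ℝ c)), fun i => ?_⟩
  rw [InnerProductSpace.toDual_symm_apply]
  simp

/-- Maximize `⟨d, w x⟩` over `w`, where `d` has positive product with every simple root. If `⟨w x,
αᵢ⟩ < 0`, reflecting in `αᵢ` would increase it. -/
theorem exists_isDominant_rep [Finite B] [Finite W] (x : E) : ∃ w, R.IsDominant (R.rep w x) := by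
  obtain ⟨d, hd⟩ := R.exists_inner_root_eq fun _ => 1
  obtain ⟨w, hw⟩ := Finite.exists_max fun w : W => inner ℝ d (R.rep w x)
  refine ⟨w, fun i => ?_⟩
  have h := hw (cs.simple i * w)
  rw [rep_mul_apply, rep_simple, inner_sub_right, inner_smul_right, hd, mul_one,
    sub_le_self_iff, real_inner_comm] at h
  by_contra! hneg
  exact h.not_gt (div_neg_of_neg_of_pos (by linarith) (R.inner_root_self_pos i))

theorem mem_map_conj_iff {G : Type*} [Group G] {H : Subgroup G} {w g : G} :
    g ∈ H.map (MulAut.conj w).toMonoidHom ↔ w⁻¹ * g * w ∈ H := by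
  rw [Subgroup.mem_map]
  constructor
  · rintro ⟨h, hh, rfl⟩
    simpa [mul_assoc] using hh
  · intro h
    exact ⟨_, h, by simp [mul_assoc]⟩

theorem exists_rep_eq_self_iff_mem_map_conj [Finite B] [Finite W] (x : E) :
    ∃ (I : Set B) (w : W), ∀ g, R.rep g x = x ↔
      g ∈ (cs.standardParabolic I).map (MulAut.conj w).toMonoidHom := by
  obtain ⟨w, hw⟩ := R.exists_isDominant_rep x
  refine ⟨{i | inner ℝ (R.rep w x) (R.root i) = 0}, w⁻¹, fun g => ?_⟩
  rw [mem_map_conj_iff, ← hw.rep_eq_self_iff, inv_inv, ← rep_mul_apply, inv_mul_cancel_right,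
    rep_mul_apply, (R.rep w).injective.eq_iff]

/-- A subspace contains a point whose stabilizer fixes the whole subspace. -/
theorem exists_generic_point [Finite W] (U : Submodule ℝ E) :
    ∃ x ∈ U, ∀ g, R.rep g x = x → g ∈ R.fixingSubgroup U := by
  -- The traces on `U` of the fixed spaces of elements not fixing `U` are finitely many proper
  -- subspaces, so they do not cover `U`.
  let S : Set (Submodule ℝ U) :=
    (fun g => (R.fixedSpace g).comap U.subtype) '' {g | g ∉ R.fixingSubgroup U}
  have hS : S.Finite := (Set.toFinite _).image _
  have htop : ⊤ ∉ hS.toFinset := by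
    rw [Set.Finite.mem_toFinset]
    rintro ⟨g, hg, h⟩
    refine hg fun x hx => ?_
    have : (⟨x, hx⟩ : U) ∈ (R.fixedSpace g).comap U.subtype := by
      rw [show (R.fixedSpace g).comap U.subtype = ⊤ from h]
      exact Submodule.mem_top
    exact R.mem_fixedSpace.1 this
  have h := Subspace.biUnion_ne_univ_of_top_notMem htop
  obtain ⟨x, hx⟩ := (Set.ne_univ_iff_exists_notMem _).1 h
  refine ⟨x, x.2, fun g hg => ?_⟩
  by_contra hgU
  refine hx (Set.mem_biUnion (x := (R.fixedSpace g).comap U.subtype) ?_ (R.mem_fixedSpace.2 hg))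
  rw [Finset.mem_coe, Set.Finite.mem_toFinset]
  exact ⟨g, hgU, rfl⟩

/-- A generic point of `U` has the fixer of `U` as stabilizer, and moving it into the dominant
chamber makes that stabilizer standard. -/
theorem isParabolic_fixingSubgroup [Finite B] [Finite W] (U : Submodule ℝ E) :
    cs.IsParabolic (R.fixingSubgroup U) := by
  obtain ⟨x, hxU, hx⟩ := R.exists_generic_point U
  obtain ⟨I, w, h⟩ := R.exists_rep_eq_self_iff_mem_map_conj x
  refine ⟨I, w, ?_⟩
  ext g
  rw [← h]
  exact ⟨fun hg => hg x hxU, hx g⟩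

theorem exists_eq_fixingSubgroup [Finite B] {P : Subgroup W} (hP : cs.IsParabolic P) :
    ∃ U, P = R.fixingSubgroup U := by
  classical
  obtain ⟨I, w, rfl⟩ := hP
  -- A dominant point lying on exactly the walls indexed by `I`.
  obtain ⟨x, hx⟩ := R.exists_inner_root_eq fun i => if i ∈ I then 0 else 1
  have hdom : R.IsDominant x := fun i => by rw [hx]; split_ifs <;> simp
  have hI : {i | inner ℝ x (R.root i) = 0} = I := by
    ext i
    simp [hx]
  refine ⟨Submodule.span ℝ {R.rep w x}, ?_⟩
  ext g
  rw [mem_map_conj_iff, ← hI, ← hdom.rep_eq_self_iff, mem_fixingSubgroup_iff_le,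
    Submodule.span_singleton_le_iff_mem, mem_fixedSpace, mul_assoc, rep_mul_apply,
    rep_inv_apply_eq_iff, rep_mul_apply]

/-- A point in the open chamber has trivial stabilizer. -/
theorem rep_eq_one_iff [Finite B] {w : W} : (∀ x, R.rep w x = x) ↔ w = 1 := by
  refine ⟨fun h => ?_, by rintro rfl; exact R.rep_one_apply⟩
  obtain ⟨d, hd⟩ := R.exists_inner_root_eq fun _ => 1
  have hdom : R.IsDominant d := fun i => by rw [hd]; simp
  have := (hdom.rep_eq_self_iff w).1 (h d)
  simpa [hd, standardParabolic] using this

end EuclideanRealization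

theorem IsParabolic.eq_closure_reflections {B W : Type*} [Group W] {M : CoxeterMatrix B}
    {cs : CoxeterSystem M W} {P : Subgroup W} (hP : cs.IsParabolic P) :
    P = Subgroup.closure {t | cs.IsReflection t ∧ t ∈ P} := by
  refine le_antisymm ?_ ((Subgroup.closure_le _).2 fun t ht => ht.2)
  obtain ⟨I, w, hP⟩ := hP
  nth_rw 1 [hP]
  rw [Subgroup.map_le_iff_le_comap, standardParabolic, Subgroup.closure_le]
  rintro _ ⟨i, hi, rfl⟩
  refine Subgroup.subset_closure ⟨⟨w, i, by simp⟩, ?_⟩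
  rw [hP]
  exact Subgroup.mem_map_of_mem _ (Subgroup.subset_closure ⟨i, hi, rfl⟩)

end CoxeterSystem

/-! ### Carter's lemma and the absolute order through fixed spaces. -/

namespace CoxeterSystem

namespace EuclideanRealization

open Module

variable {B W : Type*} [Group W] {M : CoxeterMatrix B} {cs : CoxeterSystem M W}
  {E : Type*} [NormedAddCommGroup E] [InnerProductSpace ℝ E] (R : cs.EuclideanRealization E)

theorem fixedSpace_one : R.fixedSpace 1 = ⊤ :=
  eq_top_iff.2 fun x _ => R.mem_fixedSpace.2 (R.rep_one_apply x)

theorem fixedSpace_inf_le_mul (v w : W) :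
    R.fixedSpace v ⊓ R.fixedSpace w ≤ R.fixedSpace (v * w) := by
  rintro x ⟨hv, hw⟩
  rw [SetLike.mem_coe, mem_fixedSpace] at hv hw
  rw [mem_fixedSpace, rep_mul_apply, hw, hv]

/-- Every reflection of the group acts as an orthogonal reflection. -/
theorem exists_rep_isReflection {t : W} (ht : cs.IsReflection t) :
    ∃ a : E, a ≠ 0 ∧ ∀ x, R.rep t x = x - (2 * inner ℝ a x / inner ℝ a a) • a := by
  obtain ⟨w, i, rfl⟩ := ht
  refine ⟨R.rep w (R.root i), ?_, fun x => ?_⟩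
  · rw [Ne, LinearIsometryEquiv.map_eq_zero_iff]
    exact R.root.ne_zero i
  · rw [rep_mul_apply, rep_mul_apply, rep_simple, map_sub, map_smul, ← rep_mul_apply,
      mul_inv_cancel, rep_one_apply, ← inner_rep_left, LinearIsometryEquiv.inner_map_map]

theorem finrank_le_finrank_fixedSpace_isReflection [FiniteDimensional ℝ E] {t : W}
    (ht : cs.IsReflection t) : finrank ℝ E ≤ finrank ℝ (R.fixedSpace t) + 1 := by
  obtain ⟨a, ha, h⟩ := R.exists_rep_isReflection ht
  have hle : (ℝ ∙ a)ᗮ ≤ R.fixedSpace t := by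
    intro x hx
    rw [Submodule.mem_orthogonal_singleton_iff_inner_right] at hx
    rw [mem_fixedSpace, h, hx]
    simp
  have h1 := Submodule.finrank_add_finrank_orthogonal (ℝ ∙ a)
  have h2 := Submodule.finrank_mono hle
  rw [finrank_span_singleton ha] at h1
  omega

theorem finrank_le_finrank_fixedSpace_prod [FiniteDimensional ℝ E] (l : List W)
    (hl : ∀ t ∈ l, cs.IsReflection t) :
    finrank ℝ E ≤ finrank ℝ (R.fixedSpace l.prod) + l.length := by
  induction l with
  | nil => rw [List.prod_nil, fixedSpace_one, finrank_top]; simp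
  | cons t l ih =>
    have h1 := ih fun t ht => hl t (List.mem_cons_of_mem _ ht)
    have h2 := R.finrank_le_finrank_fixedSpace_isReflection (hl t List.mem_cons_self)
    have h3 := Submodule.finrank_sup_add_finrank_inf_eq (R.fixedSpace t) (R.fixedSpace l.prod)
    have h4 := Submodule.finrank_mono (R.fixedSpace_inf_le_mul t l.prod)
    have h5 := Submodule.finrank_le (R.fixedSpace t ⊔ R.fixedSpace l.prod)
    rw [List.prod_cons, List.length_cons]
    omega

theorem range_sub_id_eq_orthogonal_fixedSpace [FiniteDimensional ℝ E] (w : W) :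
    LinearMap.range ((R.rep w).toLinearEquiv.toLinearMap - LinearMap.id) =
      (R.fixedSpace w)ᗮ := by
  refine Submodule.eq_of_le_of_finrank_eq ?_ ?_
  · rintro _ ⟨x, rfl⟩
    rw [Submodule.mem_orthogonal]
    intro y hy
    rw [mem_fixedSpace] at hy
    have h1 : inner ℝ y (R.rep w x) = inner ℝ y x := by
      nth_rw 1 [← hy]
      exact (R.rep w).inner_map_map y x
    simp [inner_sub_right, h1]
  · have h1 := LinearMap.finrank_range_add_finrank_ker
      ((R.rep w).toLinearEquiv.toLinearMap - LinearMap.id)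
    have h2 := Submodule.finrank_add_finrank_orthogonal (R.fixedSpace w)
    rw [fixedSpace] at h2 ⊢
    omega

/-- A reflection fixing the fixed space of `w` can be cancelled from `w` so that the fixed space
grows. -/
theorem fixedSpace_lt_fixedSpace_mul [FiniteDimensional ℝ E] {t w : W}
    (ht : cs.IsReflection t) (h : R.fixedSpace w ≤ R.fixedSpace t) :
    R.fixedSpace w < R.fixedSpace (t * w) := by
  obtain ⟨a, ha, hta⟩ := R.exists_rep_isReflection ht
  have haa : inner ℝ a a ≠ 0 := inner_self_ne_zero.2 ha
  have hmem : a ∈ (R.fixedSpace w)ᗮ := by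
    rw [Submodule.mem_orthogonal']
    intro y hy
    have h1 := R.mem_fixedSpace.1 (h hy)
    rw [hta, sub_eq_self, smul_eq_zero, div_eq_zero_iff] at h1
    simpa [ha] using h1
  -- Write the root as `a = w x - x`. Since `w x` and `x` have equal norm, `t` exchanges them, so `t
  -- w` fixes `x` while `w` does not.
  rw [← R.range_sub_id_eq_orthogonal_fixedSpace] at hmem
  obtain ⟨x, hx⟩ := hmem
  have hwx : R.rep w x = x + a := by
    rw [← hx]
    simp
  refine lt_of_le_of_ne ((le_inf h le_rfl).trans (R.fixedSpace_inf_le_mul t w)) fun heq => ?_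
  have hx' : x ∈ R.fixedSpace (t * w) := by
    have h1 := (R.rep w).inner_map_map x x
    rw [hwx, inner_add_left, inner_add_right, inner_add_right, real_inner_comm a x] at h1
    have h2 : 2 * inner ℝ a (x + a) / inner ℝ a a = 1 := by
      rw [div_eq_one_iff_eq haa, inner_add_right]
      linarith
    rw [mem_fixedSpace, rep_mul_apply, hwx, hta, h2, one_smul, add_sub_cancel_right]
  rw [← heq, mem_fixedSpace, hwx, add_eq_left] at hx'
  exact ha hx'

/-- Induction on the codimension of `Fix(w)`. If `w ≠ 1`, the fixer of `Fix(w)` is a nontrivial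
parabolic subgroup, so it contains a reflection `t`, and `t w` has a larger fixed space. -/
theorem reflLength_add_finrank_fixedSpace_le [Finite B] [Finite W] (n : ℕ) :
    ∀ w : W, finrank ℝ E - finrank ℝ (R.fixedSpace w) = n →
      cs.reflLength w + finrank ℝ (R.fixedSpace w) ≤ finrank ℝ E := by
  have : FiniteDimensional ℝ E := R.root.finiteDimensional_of_finite
  induction n using Nat.strong_induction_on with
  | _ n ih =>
  intro w hw
  rcases eq_or_ne w 1 with rfl | hw1
  · rw [reflLength_one, zero_add]
    exact Submodule.finrank_le _
  obtain ⟨t, ht, htw⟩ : ∃ t, cs.IsReflection t ∧ t ∈ R.fixingSubgroup (R.fixedSpace w) := by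
    by_contra! hne
    have hP := (R.isParabolic_fixingSubgroup (R.fixedSpace w)).eq_closure_reflections
    have h0 : {t | cs.IsReflection t ∧ t ∈ R.fixingSubgroup (R.fixedSpace w)} = ∅ :=
      Set.eq_empty_iff_forall_notMem.2 fun t ht => hne t ht.1 ht.2
    rw [h0, Subgroup.closure_empty] at hP
    have hmem : w ∈ R.fixingSubgroup (R.fixedSpace w) := R.mem_fixingSubgroup_iff_le.2 le_rfl
    rw [hP, Subgroup.mem_bot] at hmem
    exact hw1 hmem
  have hlt := Submodule.finrank_lt_finrank_of_lt
    (R.fixedSpace_lt_fixedSpace_mul ht (R.mem_fixingSubgroup_iff_le.1 htw))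
  have h1 := Submodule.finrank_le (R.fixedSpace (t * w))
  have h2 := ih _ (by omega) (t * w) rfl
  have h3 := cs.reflLength_mul_le t (t * w)
  rw [← mul_assoc, ht.mul_self, one_mul] at h3
  have h4 : cs.reflLength t ≤ 1 :=
    cs.reflLength_le ⟨[t], by simpa using ht, by simp, rfl⟩
  omega

/-- **Carter's lemma**: the reflection length is the codimension of the fixed space. -/
theorem reflLength_add_finrank_fixedSpace [Finite B] [Finite W] (w : W) :
    cs.reflLength w + finrank ℝ (R.fixedSpace w) = finrank ℝ E := by
  have : FiniteDimensional ℝ E := R.root.finiteDimensional_of_finite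
  refine le_antisymm (R.reflLength_add_finrank_fixedSpace_le _ w rfl) ?_
  obtain ⟨l, hl, hw, hk⟩ := cs.isProdOfReflections_reflLength w
  have := R.finrank_le_finrank_fixedSpace_prod l hl
  rw [hw, hk] at this
  omega

theorem parabolicClosure_eq [Finite B] [Finite W] (w : W) :
    cs.parabolicClosure w = R.fixingSubgroup (R.fixedSpace w) := by
  refine le_antisymm (sInf_le ⟨R.isParabolic_fixingSubgroup _,
    R.mem_fixingSubgroup_iff_le.2 le_rfl⟩) (le_sInf ?_)
  rintro P ⟨hP, hw⟩
  obtain ⟨U, rfl⟩ := R.exists_eq_fixingSubgroup hP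
  rw [mem_fixingSubgroup_iff_le] at hw
  exact fun g hg x hx => hg x (hw hx)

theorem mem_parabolicClosure_iff [Finite B] [Finite W] {v w : W} :
    v ∈ cs.parabolicClosure w ↔ R.fixedSpace w ≤ R.fixedSpace v := by
  rw [R.parabolicClosure_eq, mem_fixingSubgroup_iff_le]

theorem parabolicClosure_le_iff [Finite B] [Finite W] {v w : W} :
    cs.parabolicClosure v ≤ cs.parabolicClosure w ↔ R.fixedSpace w ≤ R.fixedSpace v := by
  refine ⟨fun h => R.mem_parabolicClosure_iff.1 (h (R.mem_parabolicClosure_iff.2 le_rfl)),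
    fun h g hg => ?_⟩
  rw [R.mem_parabolicClosure_iff] at hg ⊢
  exact h.trans hg

/-- By Carter's lemma the order says that codimensions add, which is the equality case of `Fix(v) ∩
Fix(v⁻¹w) ⊆ Fix(w)` together with the dimension formula. -/
theorem absLE_iff [Finite B] [Finite W] {v w : W} :
    cs.AbsLE v w ↔ R.fixedSpace v ⊓ R.fixedSpace (v⁻¹ * w) = R.fixedSpace w ∧
      R.fixedSpace v ⊔ R.fixedSpace (v⁻¹ * w) = ⊤ := by
  have : FiniteDimensional ℝ E := R.root.finiteDimensional_of_finite
  have h1 := R.reflLength_add_finrank_fixedSpace v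
  have h2 := R.reflLength_add_finrank_fixedSpace (v⁻¹ * w)
  have h3 := R.reflLength_add_finrank_fixedSpace w
  have h4 := Submodule.finrank_sup_add_finrank_inf_eq (R.fixedSpace v) (R.fixedSpace (v⁻¹ * w))
  have hle := R.fixedSpace_inf_le_mul v (v⁻¹ * w)
  rw [mul_inv_cancel_left] at hle
  have h5 := Submodule.finrank_mono hle
  have h6 := Submodule.finrank_le (R.fixedSpace v ⊔ R.fixedSpace (v⁻¹ * w))
  rw [AbsLE]
  constructor
  · intro h
    exact ⟨Submodule.eq_of_le_of_finrank_eq hle (by omega),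
      Submodule.eq_top_of_finrank_eq (by omega)⟩
  · rintro ⟨ha, hb⟩
    rw [ha, hb, finrank_top] at h4
    omega

theorem rep_apply_rep_apply_of_sq_eq_one {u : W} (hu : u ^ 2 = 1) (x : E) :
    R.rep u (R.rep u x) = x := by
  rw [← rep_mul_apply, ← pow_two, hu, rep_one_apply]

theorem add_rep_mem_fixedSpace {u : W} (hu : u ^ 2 = 1) (x : E) :
    x + R.rep u x ∈ R.fixedSpace u := by
  rw [mem_fixedSpace, map_add, R.rep_apply_rep_apply_of_sq_eq_one hu, add_comm]

/-- The elements below an involution `u` are the involutions whose fixed space contains that of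
`u`. -/
theorem absLE_iff_of_sq_eq_one [Finite B] [Finite W] {v u : W} (hu : u ^ 2 = 1) :
    cs.AbsLE v u ↔ v ^ 2 = 1 ∧ R.fixedSpace u ≤ R.fixedSpace v := by
  rw [R.absLE_iff]
  constructor
  · rintro ⟨hinf, hsup⟩
    have hle : R.fixedSpace u ≤ R.fixedSpace v := hinf ▸ inf_le_left
    refine ⟨?_, hle⟩
    rw [← R.rep_eq_one_iff]
    intro x
    -- Write `x = y + z` with `v y = y` and `v z = u z`. Then `z + u z` lies in `Fix(u) ⊆ Fix(v)`,
    -- which gives `v (v z) = z`.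
    have hx : x ∈ R.fixedSpace v ⊔ R.fixedSpace (v⁻¹ * u) := hsup ▸ Submodule.mem_top
    obtain ⟨y, hy, z, hz, rfl⟩ := Submodule.mem_sup.1 hx
    rw [mem_fixedSpace] at hy hz
    rw [rep_mul_apply, rep_inv_apply_eq_iff] at hz
    have h1 := R.mem_fixedSpace.1 (hle (R.add_rep_mem_fixedSpace hu z))
    rw [map_add, hz, add_comm, add_right_cancel_iff] at h1
    rw [pow_two, rep_mul_apply, map_add, map_add, hy, hy, h1]
  · rintro ⟨hv, hle⟩
    constructor
    · refine le_antisymm ?_ (le_inf hle fun x hx => ?_)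
      · simpa using R.fixedSpace_inf_le_mul v (v⁻¹ * u)
      · have hxv := R.mem_fixedSpace.1 (hle hx)
        rw [mem_fixedSpace] at hx
        rw [mem_fixedSpace, rep_mul_apply, rep_inv_apply_eq_iff, hx, hxv]
    · refine eq_top_iff.2 fun x _ => ?_
      -- The vector `y = x - v x` is negated by `v`, hence orthogonal to `y + u y`, which `v` fixes.
      -- So `‖y + u y‖² = 2⟨y, y + u y⟩ = 0` and `u y = -y = v y`.
      have hy : x - R.rep v x ∈ R.fixedSpace (v⁻¹ * u) := by
        set y := x - R.rep v x with hydef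
        have hvy : R.rep v y = -y := by
          rw [hydef, map_sub, R.rep_apply_rep_apply_of_sq_eq_one hv]
          abel
        have h1 := R.mem_fixedSpace.1 (hle (R.add_rep_mem_fixedSpace hu y))
        have h2 := (R.rep v).inner_map_map y (y + R.rep u y)
        rw [h1, hvy, inner_neg_left, inner_add_right] at h2
        have h3 : y + R.rep u y = 0 := by
          rw [← inner_self_eq_zero (𝕜 := ℝ), inner_add_left, inner_add_right, inner_add_right,
            (R.rep u).inner_map_map, real_inner_comm y (R.rep u y)]
          linarith
        rw [mem_fixedSpace, rep_mul_apply, rep_inv_apply_eq_iff, hvy]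
        exact eq_neg_of_add_eq_zero_right h3
      have hx : x = (2⁻¹ : ℝ) • (x + R.rep v x) + (2⁻¹ : ℝ) • (x - R.rep v x) := by module
      rw [hx]
      exact Submodule.add_mem_sup (Submodule.smul_mem _ _ (R.add_rep_mem_fixedSpace hv x))
        (Submodule.smul_mem _ _ hy)

end EuclideanRealization

end CoxeterSystem

/-! ### The interval below an involution and its parabolic closures. -/

namespace CoxeterSystem

theorem mem_parabolicClosure_self {B W : Type*} [Group W] {M : CoxeterMatrix B}
    (cs : CoxeterSystem M W) (w : W) : w ∈ cs.parabolicClosure w :=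
  Subgroup.mem_sInf.2 fun _ hP => hP.2

theorem absLE_one {B W : Type*} [Group W] {M : CoxeterMatrix B}
    (cs : CoxeterSystem M W) (w : W) : cs.AbsLE 1 w := by
  simp [AbsLE, reflLength_one]

section Involutions

variable {B W : Type*} [Group W] [Finite W] {M : CoxeterMatrix B} (cs : CoxeterSystem M W)

theorem isParabolic_parabolicClosure (w : W) : cs.IsParabolic (cs.parabolicClosure w) := by
  have := cs.finite_index
  obtain ⟨_, _, ⟨R⟩⟩ := cs.exists_euclideanRealization
  rw [R.parabolicClosure_eq]
  exact R.isParabolic_fixingSubgroup _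

/-- The intersection of two fixers is the fixer of the sum of the subspaces. -/
theorem isParabolic_parabolicClosure_inf (v w : W) :
    cs.IsParabolic (cs.parabolicClosure v ⊓ cs.parabolicClosure w) := by
  have := cs.finite_index
  obtain ⟨_, _, ⟨R⟩⟩ := cs.exists_euclideanRealization
  have : cs.parabolicClosure v ⊓ cs.parabolicClosure w =
      R.fixingSubgroup (R.fixedSpace v ⊔ R.fixedSpace w) := by
    ext g
    rw [Subgroup.mem_inf, R.mem_parabolicClosure_iff, R.mem_parabolicClosure_iff,
      R.mem_fixingSubgroup_iff_le, sup_le_iff]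
  rw [this]
  exact R.isParabolic_fixingSubgroup _

theorem absLE_iff_parabolicClosure_le {v u : W} (hu : u ^ 2 = 1) :
    cs.AbsLE v u ↔ v ^ 2 = 1 ∧ cs.parabolicClosure v ≤ cs.parabolicClosure u := by
  have := cs.finite_index
  obtain ⟨_, _, ⟨R⟩⟩ := cs.exists_euclideanRealization
  rw [R.absLE_iff_of_sq_eq_one hu, R.parabolicClosure_le_iff]

theorem parabolicClosure_le_of_mem {v w : W} (h : v ∈ cs.parabolicClosure w) :
    cs.parabolicClosure v ≤ cs.parabolicClosure w :=
  sInf_le ⟨cs.isParabolic_parabolicClosure w, h⟩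

variable {cs} {u : W}

theorem absInterval_sq (hu : u ^ 2 = 1) (v : cs.AbsInterval 1 u) : v.1 ^ 2 = 1 :=
  ((cs.absLE_iff_parabolicClosure_le hu).1 v.2.2).1

/-- Every `w` in the interval is itself an involution, so the description of the elements below `u`
applies to `w` as well. -/
theorem absInterval_le_iff (hu : u ^ 2 = 1) (v w : cs.AbsInterval 1 u) :
    v ≤ w ↔ cs.parabolicClosure v.1 ≤ cs.parabolicClosure w.1 := by
  change cs.AbsLE v.1 w.1 ↔ _
  rw [cs.absLE_iff_parabolicClosure_le (absInterval_sq hu w)]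
  exact and_iff_right (absInterval_sq hu v)

theorem parabolicClosure_mem_involutiveParabolics (hu : u ^ 2 = 1)
    (v : cs.AbsInterval 1 u) : cs.parabolicClosure v.1 ∈ cs.involutiveParabolics u :=
  ⟨⟨cs.isParabolic_parabolicClosure _, v.1, absInterval_sq hu v, rfl⟩,
    ((cs.absLE_iff_parabolicClosure_le hu).1 v.2.2).2⟩

theorem exists_parabolicClosure_eq (hu : u ^ 2 = 1) {P : Subgroup W}
    (hP : P ∈ cs.involutiveParabolics u) :
    ∃ v : cs.AbsInterval 1 u, cs.parabolicClosure v.1 = P := by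
  obtain ⟨⟨-, x, hx, rfl⟩, hle⟩ := hP
  exact ⟨⟨x, cs.absLE_one x, (cs.absLE_iff_parabolicClosure_le hu).2 ⟨hx, hle⟩⟩, rfl⟩

/-- Reflections generate the intersection and are involutions, so they belong to the interval and
can be tested against `m`. Only the meet of this one pair has to exist. -/
theorem parabolicClosure_isGLB (hu : u ^ 2 = 1) {v w m : cs.AbsInterval 1 u}
    (hm : IsGLB {v, w} m) :
    cs.parabolicClosure m.1 = cs.parabolicClosure v.1 ⊓ cs.parabolicClosure w.1 := by
  refine le_antisymm (le_inf ?_ ?_) ?_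
  · exact (absInterval_le_iff hu _ _).1 (hm.1 (by simp))
  · exact (absInterval_le_iff hu _ _).1 (hm.1 (by simp))
  rw [(cs.isParabolic_parabolicClosure_inf v.1 w.1).eq_closure_reflections, Subgroup.closure_le]
  rintro t ⟨ht, htv, htw⟩
  have htv' := cs.parabolicClosure_le_of_mem htv
  have htw' := cs.parabolicClosure_le_of_mem htw
  let t' : cs.AbsInterval 1 u := ⟨t, cs.absLE_one t, (cs.absLE_iff_parabolicClosure_le hu).2
    ⟨by rw [pow_two, ht.mul_self],
      htv'.trans ((cs.absLE_iff_parabolicClosure_le hu).1 v.2.2).2⟩⟩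
  have hle : t' ≤ m := hm.2 (by
    rintro x (rfl | rfl)
    · exact (absInterval_le_iff hu t' _).2 htv'
    · exact (absInterval_le_iff hu t' _).2 htw')
  exact (absInterval_le_iff hu _ _).1 hle (cs.mem_parabolicClosure_self t)

theorem exists_isGLB_of_inf_mem (hu : u ^ 2 = 1)
    (h : ∀ P ∈ cs.involutiveParabolics u,
    ∀ Q ∈ cs.involutiveParabolics u, P ⊓ Q ∈ cs.involutiveParabolics u)
    (v w : cs.AbsInterval 1 u) : ∃ m, IsGLB {v, w} m := by
  obtain ⟨m, hm⟩ := exists_parabolicClosure_eq hu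
    (h _ (parabolicClosure_mem_involutiveParabolics hu v) _
      (parabolicClosure_mem_involutiveParabolics hu w))
  refine ⟨m, ?_, fun x hx => ?_⟩
  · rintro x (rfl | rfl) <;> rw [absInterval_le_iff hu, hm]
    · exact inf_le_left
    · exact inf_le_right
  · rw [absInterval_le_iff hu, hm]
    exact le_inf ((absInterval_le_iff hu _ _).1 (hx (by simp)))
      ((absInterval_le_iff hu _ _).1 (hx (by simp)))

end Involutions

end CoxeterSystem

/-! ### From binary meets to lattices, and the theorem. -/

/-- A finite partially ordered set with a top element and binary meets is a lattice. -/
theorem isLatticeOrder_of_finite_of_isGLB {α : Type*} [PartialOrder α] [Finite α] {t : α}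
    (ht : IsTop t) (h : ∀ a b : α, ∃ m, IsGLB {a, b} m) : IsLatticeOrder α := by
  refine fun a b => ⟨h a b, ?_⟩
  -- A minimal upper bound is least: its meet with any other upper bound is again an upper bound,
  -- hence equals it.
  obtain ⟨j, hj⟩ := (Set.toFinite (upperBounds {a, b})).exists_minimal ⟨t, fun x _ => ht x⟩
  refine ⟨j, hj.1, fun z hz => ?_⟩
  obtain ⟨m, hm⟩ := h j z
  have hmj : m ≤ j := hm.1 (by simp)
  have hmu : m ∈ upperBounds {a, b} := fun x hx => hm.2 (by
    rintro y (rfl | rfl)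
    · exact hj.1 hx
    · exact hz hx)
  exact (hj.2 hmu hmj).trans (hm.1 (by simp))

theorem mainTheorem3 {B W : Type*} [Group W] [Finite W] {M : CoxeterMatrix B}
    (cs : CoxeterSystem M W) (u : W) (hu : u ^ 2 = 1) :
    (IsLatticeOrder (cs.AbsInterval 1 u) ↔
      ∀ P ∈ cs.involutiveParabolics u, ∀ Q ∈ cs.involutiveParabolics u,
        P ⊓ Q ∈ cs.involutiveParabolics u) ∧
    (IsLatticeOrder (cs.AbsInterval 1 u) →
      ∀ v w m : cs.AbsInterval 1 u, IsGLB {v, w} m →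
        cs.parabolicClosure m.1 = cs.parabolicClosure v.1 ⊓ cs.parabolicClosure w.1) := by
  refine ⟨⟨fun hlat P hP Q hQ => ?_, fun h => ?_⟩,
    fun _ v w m hm => CoxeterSystem.parabolicClosure_isGLB hu hm⟩
  · obtain ⟨v, rfl⟩ := CoxeterSystem.exists_parabolicClosure_eq hu hP
    obtain ⟨w, rfl⟩ := CoxeterSystem.exists_parabolicClosure_eq hu hQ
    obtain ⟨m, hm⟩ := (hlat v w).1
    rw [← CoxeterSystem.parabolicClosure_isGLB hu hm]
    exact CoxeterSystem.parabolicClosure_mem_involutiveParabolics hu m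
  · have : Finite (cs.AbsInterval 1 u) := Subtype.finite
    exact isLatticeOrder_of_finite_of_isGLB (t := ⟨u, cs.absLE_one u, cs.absLE_refl u⟩)
      (fun v => v.2.2) (CoxeterSystem.exists_isGLB_of_inf_mem hu h)
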